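/- Let $1\le k\le n$ be integers, let $A=(a_{ij})\in\mathbb{R}^{n\times n}$, let $\eta>0$, and suppose that there exist $d_1,\dots,d_n>0$ such that \[ -(n-k-1)\,a_{ii}+\sum_{j\neq i}\Big(a_{jj}+(n-k)\frac{d_j}{d_i}|a_{ji}|\Big)\le-\eta<0\qquad\text{for all } i\in\{1,\dots,n\}. \] Put $D:=\operatorname{diag}(d_1,\dots,d_n)$. For a matrix $M$ let $M^{(k)}$ denote its $k$-multiplicative compound (the matrix of all $k\times k$ minors of $M$), and for a square matrix $M$ let $M^{[k]}:=\frac{d}{d\varepsilon}(I+\varepsilon M)^{(k)}\big|_{\varepsilon=0}$ be its $k$-additive compound. Let $|y|_{\infty,D^{(k)}}:=|D^{(k)}y|_\infty$ for $y\in\mathbb{R}^{\binom nk}$, with induced matrix norm $\|M\|:=\max_{|y|_{\infty,D^{(k)}}=1}|My|_{\infty,D^{(k)}}$ and log norm $\mu_{\infty,D^{(k)}}(M):=\lim_{\varepsilon\downarrow0}(\|I+\varepsilon M\|-1)/\varepsilon$. Then the linear system $\dot x=Ax$ is $k$-contractive with rate $\eta$ with respect to the $L_\infty$ norm scaled by $D$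 (that is, with respect to $|\cdot|_{\infty,D^{(k)}}$ on $k$-fold wedge products). Explicitly, it satisfies the infinitesimal condition \[ \mu_{\infty,D^{(k)}}\big(A^{[k]}\big)\le-\eta , \] and for all $0\le s\le t$ and all solutions $x^1,\dots,x^k$ of $\dot x=Ax$ on $[s,t]$, \[ \Big|\big[x^1(t)\ \cdots\ x^k(t)\big]^{(k)}\Big|_{\infty,D^{(k)}}\le e^{-\eta(t-s)}\,\Big|\big[x^1(s)\ \cdots\ x^k(s)\big]^{(k)}\Big|_{\infty,D^{(k)}} . \] -/

import Mathlib

open Filter Topology Set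

noncomputable section

/-- `Q(k, n)`: the increasing sequences of `k` indices out of `n`. Compound matrices are indexed
by these sequences directly (the order in which they are listed plays no role below). -/
abbrev IncSeq (k n : ℕ) : Type := Fin k ↪o Fin n

instance instFiniteIncSeq (k n : ℕ) : Finite (IncSeq k n) :=
  Finite.of_injective (fun α : IncSeq k n => (α : Fin k → Fin n)) DFunLike.coe_injective

instance instFintypeIncSeq (k n : ℕ) : Fintype (IncSeq k n) := Fintype.ofFinite _

instance instDecidableEqIncSeq (k n : ℕ) : DecidableEq (IncSeq k n) := Classical.decEq _

/-- The `k`-multiplicative compound `A^(k)`: the matrix of all `k`-minors of `A`. -/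
def mulCompound {R : Type*} [CommRing R] {n m : ℕ} (k : ℕ) (A : Matrix (Fin n) (Fin m) R) :
    Matrix (IncSeq k n) (IncSeq k m) R :=
  Matrix.of fun α β => (A.submatrix α β).det

/-- The `k`-additive compound `A^[k]`: the (entrywise) derivative of `(I + ε A)^(k)` with respect
to `ε` at `ε = 0`; every entry is a polynomial in `ε`. -/
def addCompound {n : ℕ} (k : ℕ) (A : Matrix (Fin n) (Fin n) ℝ) :
    Matrix (IncSeq k n) (IncSeq k n) ℝ :=
  Matrix.of fun α β => deriv (fun ε : ℝ => mulCompound k (1 + ε • A) α β) 0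

/-- The `L_∞` norm scaled by `H`, `|x|_{∞,H} = |H x|_∞`
(the norm of a finite product of copies of `ℝ` is the maximum norm). -/
def scaledSupNorm {ι : Type*} [Fintype ι] (H : Matrix ι ι ℝ) (x : ι → ℝ) : ℝ :=
  ‖H.mulVec x‖

/-- The matrix norm `max_{|x| = 1} |A x|` induced by a vector norm `N`. -/
def inducedNorm {ι : Type*} [Fintype ι] (N : (ι → ℝ) → ℝ) (A : Matrix ι ι ℝ) : ℝ :=
  sSup {y : ℝ | ∃ x : ι → ℝ, N x = 1 ∧ y = N (A.mulVec x)}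

/-- `m` is the value at `A` of the log norm induced by `N`, that is
`m = lim_{ε ↓ 0} (‖I + ε A‖ - 1) / ε`. -/
def IsLogNorm {ι : Type*} [Fintype ι] [DecidableEq ι] (N : (ι → ℝ) → ℝ) (A : Matrix ι ι ℝ)
    (m : ℝ) : Prop :=
  Tendsto (fun ε : ℝ => (inducedNorm N (1 + ε • A) - 1) / ε) (𝓝[>] 0) (𝓝 m)

/-- The wedge product of `k` vectors of `ℝ^n` in coordinates: the only column of the
`k`-multiplicative compound of the `n × k` matrix with columns `w 0, …, w (k - 1)`. Its size
measures the `k`-dimensional parallelotope spanned by these vectors. -/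
def wedge {n k : ℕ} (w : Fin k → Fin n → ℝ) : IncSeq k n → ℝ :=
  fun α => mulCompound k (Matrix.of fun i j => w j i) α (RelEmbedding.refl _)

/-- The system `x' = f(t, x)` on `Ω` is `k`-contractive with rate `η` with respect to the norm `N`
(a norm on the space of wedge products of `k` vectors): along every solution `x` in `Ω` on a time
interval `[s, t]` with `s ≥ 0`, every `k` solutions of the variational equation
`w' = (∂f/∂x)(τ, x(τ)) w` span parallelotopes whose size decays at least like `exp (-η (t - s))`. -/
def IsKContractive {n : ℕ} (k : ℕ) (N : (IncSeq k n → ℝ) → ℝ) (η : ℝ)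
    (f : ℝ → (Fin n → ℝ) → (Fin n → ℝ)) (Ω : Set (Fin n → ℝ)) : Prop :=
  ∀ (s t : ℝ), 0 ≤ s → s ≤ t →
    ∀ (x : ℝ → Fin n → ℝ) (w : Fin k → ℝ → Fin n → ℝ),
      (∀ τ ∈ Icc s t, x τ ∈ Ω ∧ HasDerivWithinAt x (f τ (x τ)) (Icc s t) τ) →
      (∀ i, ∀ τ ∈ Icc s t,
        HasDerivWithinAt (w i) (fderivWithin ℝ (f τ) Ω (x τ) (w i τ)) (Icc s t) τ) →
      N (wedge fun i => w i t) ≤ Real.exp (-η * (t - s)) * N (wedge fun i => w i s)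

/-- The infinitesimal condition for `k`-contraction with rate `η`:
`μ(J^[k](t, x)) ≤ -η` for all `t ≥ 0` and `x ∈ Ω`, where `J = ∂f/∂x` and `μ` is the log norm
induced by `N`. -/
def InfinitesimallyKContractive {n : ℕ} (k : ℕ) (N : (IncSeq k n → ℝ) → ℝ) (η : ℝ)
    (f : ℝ → (Fin n → ℝ) → (Fin n → ℝ)) (Ω : Set (Fin n → ℝ)) : Prop :=
  ∀ t : ℝ, 0 ≤ t → ∀ x ∈ Ω, ∃ m : ℝ,
    IsLogNorm N
      (addCompound k (LinearMap.toMatrix' (fderivWithin ℝ (f t) Ω x : (Fin n → ℝ) →ₗ[ℝ] (Fin n → ℝ))))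
      m ∧ m ≤ -η

end

/-! The compound of `diag d` is diagonal with positive entries `∏ p, d (α p)`, so everything happens
in a weighted sup norm, whose log norm is the largest weighted row sum. In row `α` of `A^[k]`, with
index set `S`, the diagonal entry is the sum of `A i i` over `S`. Off the diagonal, exchanging `i ∈
S` for `l ∉ S` costs at most `d i / d l * |A i l|` (`sum_abs_addCompound_le`). Averaging the
hypothesis over the `n - k` indices outside `S` bounds this row sum by `-η`
(`sum_diag_add_sum_compl_le`). This gives the log norm bound. As wedge products solve `y' = A^[k] y`
(`hasDerivWithinAt_mulCompound`), Grönwall's inequality turns the same row bound into decay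
(`scaledSupNorm_le_exp_mul`). -/

/-! ### Minors along arbitrary row sequences -/

theorem exists_incSeq_comp_perm {k n : ℕ} {γ : Fin k → Fin n} (hγ : Function.Injective γ) :
    ∃ (β : IncSeq k n) (σ : Equiv.Perm (Fin k)), γ = β ∘ σ := by
  refine ⟨OrderEmbedding.ofStrictMono (γ ∘ Tuple.sort γ)
    ((Tuple.monotone_sort γ).strictMono_of_injective (hγ.comp (Tuple.sort γ).injective)),
    (Tuple.sort γ)⁻¹, ?_⟩
  ext i
  simp

theorem IncSeq.exists_notMem_range {k n : ℕ} {α β : IncSeq k n} (h : α ≠ β) :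
    ∃ p, ∀ q, α p ≠ β q := by
  by_contra! hc
  apply h
  have hsub : Finset.univ.image α ⊆ Finset.univ.image β := by
    intro x hx
    obtain ⟨p, -, rfl⟩ := Finset.mem_image.1 hx
    obtain ⟨q, hq⟩ := hc p
    exact Finset.mem_image.2 ⟨q, Finset.mem_univ _, hq.symm⟩
  have heq : Finset.univ.image α = Finset.univ.image β := by
    apply Finset.eq_of_subset_of_card_le hsub
    rw [Finset.card_image_of_injective _ α.injective, Finset.card_image_of_injective _ β.injective]
  have hr : Set.range α = Set.range β := by
    have := congrArg (fun s : Finset (Fin n) => (s : Set (Fin n))) heq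
    simpa using this
  exact DFunLike.coe_injective ((α.strictMono.range_inj β.strictMono).1 hr)

/-- The compound of a diagonal matrix is diagonal. -/
theorem mulCompound_diagonal {k n : ℕ} (d : Fin n → ℝ) :
    mulCompound k (Matrix.diagonal d) =
      Matrix.diagonal fun α : IncSeq k n => ∏ p, d (α p) := by
  ext α β
  rw [mulCompound, Matrix.of_apply]
  by_cases h : α = β
  · subst h
    rw [Matrix.diagonal_apply_eq, Matrix.submatrix_diagonal _ _ α.injective, Matrix.det_diagonal]
    rfl
  · obtain ⟨p, hp⟩ := IncSeq.exists_notMem_range h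
    rw [Matrix.diagonal_apply_ne _ h]
    exact Matrix.det_eq_zero_of_row_eq_zero p fun q => Matrix.diagonal_apply_ne _ (hp q)

theorem mulCompound_one {k n : ℕ} : mulCompound k (1 : Matrix (Fin n) (Fin n) ℝ) = 1 := by
  rw [← Matrix.diagonal_one, mulCompound_diagonal]
  simp

theorem det_submatrix_comp_perm {k n : ℕ} {ι : Type*} (X : Matrix (Fin n) ι ℝ)
    (β : Fin k → Fin n) (σ : Equiv.Perm (Fin k)) (c : Fin k → ι) :
    (X.submatrix (β ∘ σ) c).det = (Equiv.Perm.sign σ : ℝ) * (X.submatrix β c).det := by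
  rw [← Matrix.det_permute]
  rfl

theorem det_submatrix_eq_zero_of_not_injective {k n : ℕ} {ι : Type*} (X : Matrix (Fin n) ι ℝ)
    {γ : Fin k → Fin n} (h : ¬ Function.Injective γ) (c : Fin k → ι) :
    (X.submatrix γ c).det = 0 := by
  rw [Function.not_injective_iff] at h
  obtain ⟨p, q, hpq, hne⟩ := h
  refine Matrix.det_zero_of_row_eq hne ?_
  ext j
  simp [hpq]

/-- A minor along an arbitrary sequence of rows, in terms of the minors along increasing ones. -/
theorem det_submatrix_eq_sum {k n m : ℕ} (X : Matrix (Fin n) (Fin m) ℝ) (γ : Fin k → Fin n)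
    (c : IncSeq k m) :
    (X.submatrix γ c).det = ∑ β : IncSeq k n,
      ((1 : Matrix (Fin n) (Fin n) ℝ).submatrix γ β).det * mulCompound k X β c := by
  by_cases h : Function.Injective γ
  · obtain ⟨β, σ, rfl⟩ := exists_incSeq_comp_perm h
    have h1 (δ : IncSeq k n) : ((1 : Matrix (Fin n) (Fin n) ℝ).submatrix β δ).det
        = (1 : Matrix (IncSeq k n) (IncSeq k n) ℝ) β δ := by
      rw [← mulCompound_one]; rfl
    simp only [det_submatrix_comp_perm, h1, Matrix.one_apply, mul_ite, mul_one, mul_zero, ite_mul,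
      zero_mul, Finset.sum_ite_eq, Finset.mem_univ, if_true]
    rfl
  · simp [det_submatrix_eq_zero_of_not_injective _ h]

/-- The minors of the identity along a fixed sequence of rows, weighted by the compound of a
positive diagonal matrix. -/
theorem sum_abs_det_one_submatrix_div_le {k n : ℕ} {d : Fin n → ℝ} (hd : ∀ i, 0 < d i)
    (γ : Fin k → Fin n) :
    ∑ β : IncSeq k n, |((1 : Matrix (Fin n) (Fin n) ℝ).submatrix γ β).det| / ∏ p, d (β p)
      ≤ 1 / ∏ p, d (γ p) := by
  by_cases h : Function.Injective γ
  · obtain ⟨β, σ, rfl⟩ := exists_incSeq_comp_perm h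
    have h1 (δ : IncSeq k n) : ((1 : Matrix (Fin n) (Fin n) ℝ).submatrix β δ).det
        = (1 : Matrix (IncSeq k n) (IncSeq k n) ℝ) β δ := by
      rw [← mulCompound_one]; rfl
    have h2 : ∏ p, d ((β ∘ σ) p) = ∏ p, d (β p) := Equiv.prod_comp σ fun p => d (β p)
    simp only [det_submatrix_comp_perm, h1, Matrix.one_apply, abs_mul, abs_unit_intCast, one_mul, h2]
    rw [Finset.sum_eq_single β]
    · simp
    · intro b _ hb; simp [hb.symm]
    · simp
  · simp only [det_submatrix_eq_zero_of_not_injective _ h, abs_zero, zero_div, Finset.sum_const_zero]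
    exact div_nonneg zero_le_one (Finset.prod_nonneg fun p _ => (hd _).le)

/-! ### Differentiating minors -/

/-- The derivative of the determinant of a curve of matrices, row by row. -/
theorem HasDerivWithinAt.matrix_det {k : ℕ} {X : ℝ → Matrix (Fin k) (Fin k) ℝ}
    {X' : Matrix (Fin k) (Fin k) ℝ} {s : Set ℝ} {τ : ℝ}
    (hX : ∀ i j, HasDerivWithinAt (fun t => X t i j) (X' i j) s τ) :
    HasDerivWithinAt (fun t => (X t).det) (∑ p, ((X τ).updateRow p (X' p)).det) s τ := by
  let D : ContinuousMultilinearMap ℝ (fun _ : Fin k => Fin k → ℝ) ℝ :=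
    ⟨(Matrix.detRowAlternating : (Fin k → ℝ) [⋀^Fin k]→ₗ[ℝ] ℝ).toMultilinearMap,
      continuous_id.matrix_det⟩
  have hX1 : HasDerivWithinAt (F := Fin k → Fin k → ℝ) X X' s τ :=
    hasDerivWithinAt_pi.2 fun i => hasDerivWithinAt_pi.2 fun j => hX i j
  have h := (D.hasStrictFDerivAt (x := X τ)).hasFDerivAt.comp_hasDerivWithinAt τ hX1
  exact h.congr_deriv (D.linearDeriv_apply (X τ) X')

theorem det_updateRow_sum_smul {k : ℕ} {ι : Type*} (M : Matrix (Fin k) (Fin k) ℝ) (p : Fin k)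
    (s : Finset ι) (c : ι → ℝ) (v : ι → Fin k → ℝ) :
    (M.updateRow p (∑ l ∈ s, c l • v l)).det = ∑ l ∈ s, c l * (M.updateRow p (v l)).det := by
  classical
  induction s using Finset.induction_on with
  | empty => exact Matrix.det_eq_zero_of_row_eq_zero p (by simp)
  | insert a s ha ih =>
    rw [Finset.sum_insert ha, Finset.sum_insert ha, Matrix.det_updateRow_add,
      Matrix.det_updateRow_smul, ih]

/-- The derivative of a minor along a curve `X` with `X' = A X`. -/
theorem hasDerivWithinAt_minor {k n m : ℕ} (A : Matrix (Fin n) (Fin n) ℝ)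
    {X : ℝ → Matrix (Fin n) (Fin m) ℝ} {s : Set ℝ} {τ : ℝ}
    (hX : ∀ i j, HasDerivWithinAt (fun t => X t i j) ((A * X τ) i j) s τ)
    (α : IncSeq k n) (c : IncSeq k m) :
    HasDerivWithinAt (fun t => mulCompound k (X t) α c)
      (∑ p, ∑ l, A (α p) l * ((X τ).submatrix (Function.update α p l) c).det) s τ := by
  have h := HasDerivWithinAt.matrix_det (X := fun t => (X t).submatrix α c)
    (X' := (A * X τ).submatrix α c) (s := s) (τ := τ) fun i j => hX _ _
  refine h.congr_deriv (Finset.sum_congr rfl fun p _ => ?_)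
  have hrow : ((A * X τ).submatrix α c) p = ∑ l, A (α p) l • fun j => X τ l (c j) := by
    ext j
    simp [Matrix.mul_apply]
  rw [hrow, det_updateRow_sum_smul]
  refine Finset.sum_congr rfl fun l _ => ?_
  congr 2
  ext i j
  by_cases hi : i = p
  · subst hi; simp
  · simp [Matrix.updateRow_ne hi, Function.update_of_ne hi]

theorem addCompound_apply {k n : ℕ} (A : Matrix (Fin n) (Fin n) ℝ) (α β : IncSeq k n) :
    addCompound k A α β = ∑ p, ∑ l, A (α p) l *
      ((1 : Matrix (Fin n) (Fin n) ℝ).submatrix (Function.update α p l) β).det := by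
  -- The equation `X' = A X` is needed only at `ε = 0`, where `X = 1`.
  have h := hasDerivWithinAt_minor A (X := fun ε : ℝ => 1 + ε • A) (s := univ) (τ := 0) (k := k)
    (fun i j => by
      have := ((hasDerivAt_id (0 : ℝ)).mul_const (A i j)).const_add
        ((1 : Matrix (Fin n) (Fin n) ℝ) i j)
      simpa using this) α β
  rw [hasDerivWithinAt_univ] at h
  rw [zero_smul, add_zero] at h
  exact h.deriv

/-- The compound of a solution of `X' = A X` solves `Y' = A^[k] Y`. -/
theorem hasDerivWithinAt_mulCompound {k n m : ℕ} (A : Matrix (Fin n) (Fin n) ℝ)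
    {X : ℝ → Matrix (Fin n) (Fin m) ℝ} {s : Set ℝ} {τ : ℝ}
    (hX : ∀ i j, HasDerivWithinAt (fun t => X t i j) ((A * X τ) i j) s τ)
    (α : IncSeq k n) (c : IncSeq k m) :
    HasDerivWithinAt (fun t => mulCompound k (X t) α c)
      ((addCompound k A * mulCompound k (X τ)) α c) s τ := by
  convert! hasDerivWithinAt_minor A hX α c using 1
  simp only [Matrix.mul_apply, addCompound_apply, Finset.sum_mul]
  rw [Finset.sum_comm]
  refine Finset.sum_congr rfl fun p _ => ?_
  rw [Finset.sum_comm]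
  refine Finset.sum_congr rfl fun l _ => ?_
  -- The coefficients of this expansion are the identity minors that make up `A^[k]`.
  rw [det_submatrix_eq_sum, Finset.mul_sum]
  exact Finset.sum_congr rfl fun β _ => by ring

/-! ### Row sums of the additive compound -/

theorem det_one_submatrix_update_self {k n : ℕ} (α : IncSeq k n) (p : Fin k) {l : Fin n}
    (hl : l ≠ α p) :
    ((1 : Matrix (Fin n) (Fin n) ℝ).submatrix (Function.update α p l) α).det = 0 := by
  by_cases h : ∃ q, α q = l
  · obtain ⟨q, rfl⟩ := h
    refine det_submatrix_eq_zero_of_not_injective _ (fun hinj => hl ?_) _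
    have hqp : q ≠ p := fun e => hl (by rw [e])
    exact absurd (hinj (a₁ := p) (a₂ := q) (by simp [hqp])) hqp.symm
  · refine Matrix.det_eq_zero_of_row_eq_zero p fun q => ?_
    rw [Matrix.submatrix_apply, Function.update_self,
      Matrix.one_apply_ne fun e => h ⟨q, e.symm⟩]

theorem det_one_submatrix_update_of_mem {k n : ℕ} {α β : IncSeq k n} (h : α ≠ β) (p q : Fin k) :
    ((1 : Matrix (Fin n) (Fin n) ℝ).submatrix (Function.update α p (α q)) β).det = 0 := by
  by_cases hqp : q = p
  · subst hqp
    rw [Function.update_eq_self]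
    change mulCompound k (1 : Matrix (Fin n) (Fin n) ℝ) α β = 0
    rw [mulCompound_one, Matrix.one_apply_ne h]
  · refine det_submatrix_eq_zero_of_not_injective _ (fun hinj => ?_) _
    exact absurd (hinj (a₁ := p) (a₂ := q) (by simp [hqp])) (Ne.symm hqp)

theorem addCompound_apply_self {k n : ℕ} (A : Matrix (Fin n) (Fin n) ℝ) (α : IncSeq k n) :
    addCompound k A α α = ∑ p, A (α p) (α p) := by
  rw [addCompound_apply]
  refine Finset.sum_congr rfl fun p _ => ?_
  rw [Finset.sum_eq_single (α p)]
  · have h1 : ((1 : Matrix (Fin n) (Fin n) ℝ).submatrix α α).det = 1 := by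
      rw [Matrix.submatrix_one _ α.injective, Matrix.det_one]
    rw [Function.update_eq_self, h1, mul_one]
  · intro l _ hl
    rw [det_one_submatrix_update_self α p hl, mul_zero]
  · simp

/-- An exchange of `α p` for `l` outside `α` reaches just one increasing sequence, with sign `±1`,
and the ratio of the weights collapses to `d (α p) / d l`. -/
theorem sum_abs_addCompound_le {k n : ℕ} (A : Matrix (Fin n) (Fin n) ℝ) {d : Fin n → ℝ}
    (hd : ∀ i, 0 < d i) (α : IncSeq k n) :
    ∑ β ∈ Finset.univ.erase α,
        (∏ p, d (α p)) / (∏ p, d (β p)) * |addCompound k A α β| ≤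
      ∑ p, ∑ l ∈ (Finset.univ.image α)ᶜ, d (α p) / d l * |A (α p) l| := by
  have hpos (γ : Fin k → Fin n) : 0 < ∏ p, d (γ p) := Finset.prod_pos fun p _ => hd _
  have hentry : ∀ β ∈ Finset.univ.erase α,
      (∏ p, d (α p)) / (∏ p, d (β p)) * |addCompound k A α β| ≤
        ∑ p, ∑ l ∈ (Finset.univ.image α)ᶜ, (∏ p, d (α p)) * |A (α p) l| *
          (|((1 : Matrix (Fin n) (Fin n) ℝ).submatrix (Function.update α p l) β).det|
            / ∏ p, d (β p)) := by
    intro β hβ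
    have hne : α ≠ β := (Finset.ne_of_mem_erase hβ).symm
    have hM : addCompound k A α β = ∑ p, ∑ l ∈ (Finset.univ.image α)ᶜ, A (α p) l *
        ((1 : Matrix (Fin n) (Fin n) ℝ).submatrix (Function.update α p l) β).det := by
      rw [addCompound_apply]
      refine Finset.sum_congr rfl fun p _ => ?_
      refine (Finset.sum_subset (Finset.subset_univ _) fun l _ hl => ?_).symm
      rw [Finset.mem_compl, not_not] at hl
      obtain ⟨q, -, rfl⟩ := Finset.mem_image.1 hl
      rw [det_one_submatrix_update_of_mem hne, mul_zero]
    have habs : |addCompound k A α β| ≤ ∑ p, ∑ l ∈ (Finset.univ.image α)ᶜ, |A (α p) l| *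
        |((1 : Matrix (Fin n) (Fin n) ℝ).submatrix (Function.update α p l) β).det| := by
      rw [hM]
      refine (Finset.abs_sum_le_sum_abs _ _).trans (Finset.sum_le_sum fun p _ => ?_)
      refine (Finset.abs_sum_le_sum_abs _ _).trans (Finset.sum_le_sum fun l _ => ?_)
      rw [abs_mul]
    refine (mul_le_mul_of_nonneg_left habs (div_pos (hpos α) (hpos β)).le).trans (le_of_eq ?_)
    rw [Finset.mul_sum]
    refine Finset.sum_congr rfl fun p _ => ?_
    rw [Finset.mul_sum]
    exact Finset.sum_congr rfl fun l _ => by ring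
  refine (Finset.sum_le_sum hentry).trans ?_
  rw [Finset.sum_comm]
  refine Finset.sum_le_sum fun p _ => ?_
  rw [Finset.sum_comm]
  refine Finset.sum_le_sum fun l _ => ?_
  rw [← Finset.mul_sum]
  have hle : ∑ β ∈ Finset.univ.erase α,
      |((1 : Matrix (Fin n) (Fin n) ℝ).submatrix (Function.update α p l) β).det| / ∏ p, d (β p)
        ≤ 1 / ∏ q, d (Function.update α p l q) := by
    refine le_trans ?_ (sum_abs_det_one_submatrix_div_le hd _)
    exact Finset.sum_le_sum_of_subset_of_nonneg (Finset.subset_univ _)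
      fun β _ _ => div_nonneg (abs_nonneg _) (hpos β).le
  refine (mul_le_mul_of_nonneg_left hle
    (mul_nonneg (hpos α).le (abs_nonneg _))).trans (le_of_eq ?_)
  have hprod : (∏ q, d (α q)) * d l = d (α p) * ∏ q, d (Function.update α p l q) := by
    rw [← Finset.mul_prod_erase _ _ (Finset.mem_univ p),
      ← Finset.mul_prod_erase _ (fun q => d (Function.update α p l q)) (Finset.mem_univ p)]
    have : ∏ q ∈ Finset.univ.erase p, d (Function.update α p l q) =
        ∏ q ∈ Finset.univ.erase p, d (α q) :=
      Finset.prod_congr rfl fun q hq => by rw [Function.update_of_ne (Finset.ne_of_mem_erase hq)]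
    rw [this, Function.update_self]
    ring
  have h1 := (hpos (Function.update α p l)).ne'
  have h2 := (hd l).ne'
  field_simp
  linear_combination |A (α p) l| * hprod

/-- Summing the hypothesis over the complement of a `k`-subset of the indices. -/
theorem sum_diag_add_sum_compl_le {n k : ℕ} (hk : 1 ≤ k) {A : Matrix (Fin n) (Fin n) ℝ}
    {d : Fin n → ℝ} (hd : ∀ i, 0 < d i) {η : ℝ}
    (hA : ∀ i, -((n : ℝ) - (k : ℝ) - 1) * A i i
      + ∑ j ∈ Finset.univ.erase i,
          (A j j + ((n : ℝ) - (k : ℝ)) * (d j / d i) * |A j i|) ≤ -η)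
    {s : Finset (Fin n)} (hs : s.card = k) :
    ∑ i ∈ s, A i i + ∑ i ∈ s, ∑ l ∈ sᶜ, d i / d l * |A i l| ≤ -η := by
  -- Completing the sum of the `A j j` to the full trace takes one `A i i`, so the coefficient
  -- becomes `n - k`.
  have hdiag (i : Fin n) : -((n : ℝ) - k - 1) * A i i + ∑ j ∈ Finset.univ.erase i,
      (A j j + ((n : ℝ) - k) * (d j / d i) * |A j i|) = (∑ j, A j j - ((n : ℝ) - k) * A i i)
        + ((n : ℝ) - k) * ∑ j ∈ Finset.univ.erase i, d j / d i * |A j i| := by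
    rw [Finset.sum_add_distrib, ← Finset.add_sum_erase _ (fun j => A j j) (Finset.mem_univ i),
      Finset.mul_sum]
    simp only [mul_assoc]
    ring
  have hcard : ((sᶜ.card : ℕ) : ℝ) = n - k := by
    have := Finset.card_add_card_compl s
    rw [hs, Fintype.card_fin] at this
    have hn : (k : ℝ) + (sᶜ.card : ℝ) = n := by exact_mod_cast this
    linarith
  have htr : ∑ i ∈ s, A i i + ∑ i ∈ sᶜ, A i i = ∑ i, A i i := Finset.sum_add_sum_compl s _
  by_cases hc : sᶜ = ∅
  -- Here `k = n`: there is nothing to average, but the hypothesis at any single index already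
  -- bounds the trace.
  · have hnk : (n : ℝ) - k = 0 := by rw [← hcard, hc]; simp
    obtain ⟨i, -⟩ : s.Nonempty := Finset.card_pos.1 (by omega)
    have h := hA i
    rw [hdiag, hnk] at h
    simp only [hc, Finset.sum_empty, Finset.sum_const_zero, add_zero] at htr ⊢
    rw [htr]
    linarith
  · have hm : 0 < (n : ℝ) - k := by
      rw [← hcard]
      exact_mod_cast Finset.card_pos.2 (Finset.nonempty_iff_ne_empty.2 hc)
    have h := Finset.sum_le_sum fun i (_ : i ∈ sᶜ) => (hdiag i).symm.trans_le (hA i)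
    rw [Finset.sum_add_distrib, Finset.sum_sub_distrib, ← Finset.mul_sum, ← Finset.mul_sum,
      Finset.sum_const, Finset.sum_const, nsmul_eq_mul, nsmul_eq_mul, hcard] at h
    have hoff : ∑ i ∈ s, ∑ l ∈ sᶜ, d i / d l * |A i l| ≤
        ∑ l ∈ sᶜ, ∑ j ∈ Finset.univ.erase l, d j / d l * |A j l| := by
      rw [Finset.sum_comm]
      refine Finset.sum_le_sum fun l hl => Finset.sum_le_sum_of_subset_of_nonneg ?_ ?_
      · intro i hi
        refine Finset.mem_erase.2 ⟨?_, Finset.mem_univ _⟩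
        rintro rfl
        exact Finset.mem_compl.1 hl hi
      · intro j _ _
        exact mul_nonneg (div_pos (hd _) (hd _)).le (abs_nonneg _)
    -- After summation every term carries the factor `n - k`, which cancels.
    refine le_of_mul_le_mul_left ?_ hm
    have := mul_le_mul_of_nonneg_left hoff hm.le
    rw [← htr] at h
    nlinarith

/-- The row condition on the additive compound, scaled by the compound of `diag d`. -/
theorem addCompound_row_le {n k : ℕ} (hk : 1 ≤ k) {A : Matrix (Fin n) (Fin n) ℝ}
    {d : Fin n → ℝ} (hd : ∀ i, 0 < d i) {η : ℝ}
    (hA : ∀ i, -((n : ℝ) - (k : ℝ) - 1) * A i i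
      + ∑ j ∈ Finset.univ.erase i,
          (A j j + ((n : ℝ) - (k : ℝ)) * (d j / d i) * |A j i|) ≤ -η) (α : IncSeq k n) :
    addCompound k A α α + ∑ β ∈ Finset.univ.erase α,
      (∏ p, d (α p)) / (∏ p, d (β p)) * |addCompound k A α β| ≤ -η := by
  have h := sum_diag_add_sum_compl_le hk hd hA (s := Finset.univ.image α) (by
    rw [Finset.card_image_of_injective _ α.injective, Finset.card_univ, Fintype.card_fin])
  rw [Finset.sum_image α.injective.injOn, Finset.sum_image α.injective.injOn] at h
  rw [addCompound_apply_self]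
  exact (add_le_add_right (sum_abs_addCompound_le A hd α) _).trans h

/-! ### Weighted sup norms, their log norms, and decay -/

section LogNorm

variable {ι : Type*} [Fintype ι] [DecidableEq ι]

theorem scaledSupNorm_diagonal (h x : ι → ℝ) :
    scaledSupNorm (Matrix.diagonal h) x = ‖fun i => h i * x i‖ := by
  rw [scaledSupNorm]
  congr 1
  ext i
  exact Matrix.mulVec_diagonal h x i

theorem abs_mul_mulVec_le {h : ι → ℝ} (hh : ∀ i, 0 < h i) (B : Matrix ι ι ℝ) (x : ι → ℝ) (i : ι) :
    |h i * B.mulVec x i| ≤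
      (∑ j, h i / h j * |B i j|) * scaledSupNorm (Matrix.diagonal h) x := by
  rw [scaledSupNorm_diagonal, Matrix.mulVec, dotProduct, Finset.mul_sum, Finset.sum_mul]
  refine (Finset.abs_sum_le_sum_abs _ _).trans (Finset.sum_le_sum fun j _ => ?_)
  have hj := norm_le_pi_norm (fun i => h i * x i) j
  have e : |h i * (B i j * x j)| = h i / h j * |B i j| * ‖h j * x j‖ := by
    have := (hh j).ne'
    rw [Real.norm_eq_abs, abs_mul, abs_mul, abs_mul, abs_of_pos (hh i), abs_of_pos (hh j)]
    field_simp
  rw [e]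
  exact mul_le_mul_of_nonneg_left hj (mul_nonneg (div_pos (hh i) (hh j)).le (abs_nonneg _))

theorem inducedNorm_scaledSupNorm_diagonal [Nonempty ι] {h : ι → ℝ} (hh : ∀ i, 0 < h i)
    (B : Matrix ι ι ℝ) :
    inducedNorm (scaledSupNorm (Matrix.diagonal h)) B =
      Finset.univ.sup' Finset.univ_nonempty fun i => ∑ j, h i / h j * |B i j| := by
  refine IsGreatest.csSup_eq ⟨?_, ?_⟩
  · obtain ⟨i, -, hi⟩ := Finset.exists_mem_eq_sup' (Finset.univ_nonempty (α := ι))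
      fun i => ∑ j, h i / h j * |B i j|
    -- The signs of row `i`, unscaled by `h`, attain that row's sum; zeros get sign `1` so that
    -- every `|h j * x j|` is `1`.
    let x : ι → ℝ := fun j => (if 0 ≤ B i j then 1 else -1) / h j
    have hx (j : ι) : |h j * x j| = 1 := by
      have := (hh j).ne'
      simp only [x]
      rw [mul_div_cancel₀ _ this]
      split_ifs <;> simp
    have hN : scaledSupNorm (Matrix.diagonal h) x = 1 := by
      rw [scaledSupNorm_diagonal]
      refine le_antisymm ((pi_norm_le_iff_of_nonneg zero_le_one).2 fun j => (hx j).le) ?_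
      exact (hx i).symm.trans_le (norm_le_pi_norm (fun j => h j * x j) i)
    refine ⟨x, hN, le_antisymm ?_ ?_⟩
    · rw [hi, scaledSupNorm_diagonal]
      refine le_trans (le_of_eq ?_) (norm_le_pi_norm (fun j => h j * B.mulVec x j) i)
      have hpos : h i * B.mulVec x i = ∑ j, h i / h j * |B i j| := by
        rw [Matrix.mulVec, dotProduct, Finset.mul_sum]
        refine Finset.sum_congr rfl fun j _ => ?_
        simp only [x]
        split_ifs with hB
        · rw [abs_of_nonneg hB]; ring
        · rw [abs_of_neg (not_le.1 hB)]; ring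
      rw [hpos, Real.norm_eq_abs, abs_of_nonneg]
      exact Finset.sum_nonneg fun j _ => mul_nonneg (div_pos (hh i) (hh j)).le (abs_nonneg _)
    · have hnn : 0 ≤ Finset.univ.sup' Finset.univ_nonempty fun i => ∑ j, h i / h j * |B i j| := by
        rw [hi]
        exact Finset.sum_nonneg fun j _ => mul_nonneg (div_pos (hh i) (hh j)).le (abs_nonneg _)
      rw [scaledSupNorm_diagonal, pi_norm_le_iff_of_nonneg hnn]
      intro j
      have := abs_mul_mulVec_le hh B x j
      rw [hN, mul_one] at this
      exact this.trans
        (Finset.le_sup' (fun i => ∑ j, h i / h j * |B i j|) (Finset.mem_univ j))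
  · rintro y ⟨x, hx, rfl⟩
    obtain ⟨i⟩ := ‹Nonempty ι›
    rw [scaledSupNorm_diagonal]
    refine (pi_norm_le_iff_of_nonempty _).2 fun j => ?_
    have := abs_mul_mulVec_le hh B x j
    rw [hx, mul_one] at this
    exact this.trans
      (Finset.le_sup' (fun i => ∑ j, h i / h j * |B i j|) (Finset.mem_univ j))

/-- The absolute row sums of `I + ε M`, for small `ε`. -/
theorem eventually_row_sum_one_add_smul {h : ι → ℝ} (hh : ∀ i, 0 < h i) (M : Matrix ι ι ℝ) :
    ∀ᶠ ε : ℝ in 𝓝[>] 0, ∀ i, ∑ j, h i / h j * |(1 + ε • M) i j| =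
      1 + ε * (M i i + ∑ j ∈ Finset.univ.erase i, h i / h j * |M i j|) := by
  have hdiag (i : ι) : ∀ᶠ ε : ℝ in 𝓝[>] 0, 0 ≤ 1 + ε * M i i := by
    have hc : Tendsto (fun ε : ℝ => 1 + ε * M i i) (𝓝 0) (𝓝 (1 + 0 * M i i)) :=
      (continuous_const.add (continuous_id.mul continuous_const)).tendsto 0
    rw [zero_mul, add_zero] at hc
    exact (hc.mono_left nhdsWithin_le_nhds).eventually (eventually_ge_nhds zero_lt_one)
  filter_upwards [eventually_all.2 hdiag, self_mem_nhdsWithin] with ε hε hpos i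
  have hpos : 0 < ε := hpos
  rw [← Finset.add_sum_erase _ _ (Finset.mem_univ i), div_self (hh i).ne', one_mul]
  have h1 : (1 + ε • M) i i = 1 + ε * M i i := by simp
  have h2 : ∑ j ∈ Finset.univ.erase i, h i / h j * |(1 + ε • M) i j| =
      ε * ∑ j ∈ Finset.univ.erase i, h i / h j * |M i j| := by
    rw [Finset.mul_sum]
    refine Finset.sum_congr rfl fun j hj => ?_
    have : (1 + ε • M) i j = ε * M i j := by
      simp [Matrix.one_apply_ne (Finset.ne_of_mem_erase hj).symm]
    rw [this, abs_mul, abs_of_pos hpos]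
    ring
  rw [h1, h2, abs_of_nonneg (hε i)]
  ring

/-- For small `ε > 0` the difference quotient already equals its limit, because a maximum commutes
with the increasing map `1 + ε * x`. -/
theorem isLogNorm_scaledSupNorm_diagonal [Nonempty ι] {h : ι → ℝ} (hh : ∀ i, 0 < h i)
    (M : Matrix ι ι ℝ) :
    IsLogNorm (scaledSupNorm (Matrix.diagonal h)) M
      (Finset.univ.sup' Finset.univ_nonempty fun i =>
        M i i + ∑ j ∈ Finset.univ.erase i, h i / h j * |M i j|) := by
  refine tendsto_const_nhds.congr' ?_
  filter_upwards [eventually_row_sum_one_add_smul hh M, self_mem_nhdsWithin] with ε hε hpos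
  have hpos : 0 < ε := hpos
  rw [inducedNorm_scaledSupNorm_diagonal hh]
  simp only [hε]
  rw [eq_div_iff hpos.ne', eq_sub_iff_add_eq]
  set c : ι → ℝ := fun i => M i i + ∑ j ∈ Finset.univ.erase i, h i / h j * |M i j|
  have hmono : Monotone fun x : ℝ => 1 + ε * x := fun x y hxy => by
    simpa using mul_le_mul_of_nonneg_left hxy hpos.le
  have := Finset.apply_sup'_eq_sup'_comp (Finset.univ_nonempty (α := ι)) (f := c)
    (fun x : ℝ => 1 + ε * x) (fun x y => hmono.map_sup x y)
  rw [add_comm, mul_comm]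
  exact this

/-- Exponential decay of the solutions of `y' = M y`, from the row condition on `M`. -/
theorem scaledSupNorm_le_exp_mul {h : ι → ℝ} (hh : ∀ i, 0 < h i) {M : Matrix ι ι ℝ} {η : ℝ}
    (hM : ∀ i, M i i + ∑ j ∈ Finset.univ.erase i, h i / h j * |M i j| ≤ -η)
    {y : ℝ → ι → ℝ} {s t : ℝ} (hst : s ≤ t)
    (hy : ∀ τ ∈ Icc s t, ∀ i, HasDerivWithinAt (fun τ => y τ i) (M.mulVec (y τ) i) (Icc s t) τ) :
    scaledSupNorm (Matrix.diagonal h) (y t) ≤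
      Real.exp (-η * (t - s)) * scaledSupNorm (Matrix.diagonal h) (y s) := by
  let z : ℝ → ι → ℝ := fun τ i => h i * y τ i
  let z' : ℝ → ι → ℝ := fun τ i => h i * M.mulVec (y τ) i
  have hz : ∀ τ ∈ Icc s t, HasDerivWithinAt z (z' τ) (Icc s t) τ := fun τ hτ =>
    hasDerivWithinAt_pi.2 fun i => (hy τ hτ i).const_mul (h i)
  -- A short Euler step contracts by the factor `1 - ε * η`.
  have hstep (τ : ℝ) : ∀ᶠ ε : ℝ in 𝓝[>] 0, ‖z τ + ε • z' τ‖ ≤ (1 - ε * η) * ‖z τ‖ := by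
    filter_upwards [eventually_row_sum_one_add_smul hh M, self_mem_nhdsWithin] with ε hε hpos
    have hpos : 0 < ε := hpos
    have key (i : ι) : ‖(z τ + ε • z' τ) i‖ ≤ (1 - ε * η) * ‖z τ‖ := by
      have h1 := abs_mul_mulVec_le hh (1 + ε • M) (y τ) i
      rw [hε, scaledSupNorm_diagonal] at h1
      have e : h i * (1 + ε • M).mulVec (y τ) i = (z τ + ε • z' τ) i := by
        simp only [z, z', Matrix.add_mulVec, Matrix.one_mulVec, Matrix.smul_mulVec, Pi.add_apply,
          Pi.smul_apply, smul_eq_mul]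
        ring
      rw [e] at h1
      refine h1.trans (mul_le_mul_of_nonneg_right ?_ (norm_nonneg _))
      have := mul_le_mul_of_nonneg_left (hM i) hpos.le
      linarith
    cases isEmpty_or_nonempty ι
    · rw [Subsingleton.elim (z τ + ε • z' τ) 0, Subsingleton.elim (z τ) 0, norm_zero, mul_zero]
    · exact (pi_norm_le_iff_of_nonempty _).2 key
  -- The norm need not be differentiable, so Grönwall is used in its lower right Dini derivative
  -- form.
  have hgr := le_gronwallBound_of_liminf_deriv_right_le (f := fun τ => ‖z τ‖)
    (f' := fun τ => -η * ‖z τ‖) (δ := ‖z s‖) (K := -η) (ε := 0) (a := s) (b := t)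
    (fun τ hτ => (hz τ hτ).continuousWithinAt.norm) ?_ le_rfl (fun τ _ => by simp) t
    (right_mem_Icc.2 hst)
  · rw [gronwallBound_ε0, mul_comm] at hgr
    simpa only [scaledSupNorm_diagonal] using hgr
  · intro τ hτ r hr
    apply Eventually.frequently
    have hslope : Tendsto (slope z τ) (𝓝[>] τ) (𝓝 (z' τ)) := by
      have h1 := (hz τ ⟨hτ.1, hτ.2.le⟩).mono_of_mem_nhdsWithin (Icc_mem_nhdsGT_of_mem hτ)
      rwa [hasDerivWithinAt_iff_tendsto_slope' (by simp)] at h1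
    have hδ : 0 < r - -η * ‖z τ‖ := sub_pos.2 hr
    have hshift : Tendsto (fun x => x - τ) (𝓝[>] τ) (𝓝[>] 0) := by
      refine tendsto_nhdsWithin_of_tendsto_nhds_of_eventually_within _ ?_ ?_
      · have : Tendsto (fun x : ℝ => x - τ) (𝓝 τ) (𝓝 (τ - τ)) :=
          (continuous_id.sub continuous_const).tendsto τ
        rw [sub_self] at this
        exact this.mono_left nhdsWithin_le_nhds
      · filter_upwards [self_mem_nhdsWithin] with x hx
        exact mem_Ioi.2 (sub_pos.2 (mem_Ioi.1 hx))
    filter_upwards [hslope (Metric.ball_mem_nhds _ hδ), hshift.eventually (hstep τ),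
      self_mem_nhdsWithin] with x hx1 hx2 hx3
    have hpos : 0 < x - τ := sub_pos.2 (mem_Ioi.1 hx3)
    have hx1 : ‖slope z τ x - z' τ‖ < r - -η * ‖z τ‖ := by
      simpa [dist_eq_norm] using hx1
    -- Euler step plus an error that is `o(x - τ)`.
    have hdecomp : z x = (z τ + (x - τ) • z' τ) + (x - τ) • (slope z τ x - z' τ) := by
      have := sub_smul_slope z τ x
      rw [smul_sub, this, vsub_eq_sub]
      abel
    have hnorm : ‖z x‖ ≤ (1 - (x - τ) * η) * ‖z τ‖ + (x - τ) * ‖slope z τ x - z' τ‖ := by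
      conv_lhs => rw [hdecomp]
      refine (norm_add_le _ _).trans (add_le_add hx2 ?_)
      rw [norm_smul, Real.norm_eq_abs, abs_of_pos hpos]
    rw [inv_mul_lt_iff₀ hpos]
    have := mul_lt_mul_of_pos_left hx1 hpos
    nlinarith

end LogNorm

/-! ### The linear system -/

theorem fderivWithin_mulVec_univ {n : ℕ} (A : Matrix (Fin n) (Fin n) ℝ) (x : Fin n → ℝ) :
    fderivWithin ℝ (fun x : Fin n → ℝ => A.mulVec x) univ x =
      LinearMap.toContinuousLinearMap (Matrix.toLin' A) := by
  rw [fderivWithin_univ]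
  exact (LinearMap.toContinuousLinearMap (Matrix.toLin' A)).hasFDerivAt.fderiv

theorem mainTheorem8 (n k : ℕ) (hk : 1 ≤ k) (hkn : k ≤ n)
    (A : Matrix (Fin n) (Fin n) ℝ) (d : Fin n → ℝ) (hd : ∀ i, 0 < d i)
    (η : ℝ) (hη : 0 < η)
    (hA : ∀ i, -((n : ℝ) - (k : ℝ) - 1) * A i i
      + ∑ j ∈ Finset.univ.erase i,
          (A j j + ((n : ℝ) - (k : ℝ)) * (d j / d i) * |A j i|) ≤ -η) :
    InfinitesimallyKContractive k (scaledSupNorm (mulCompound k (Matrix.diagonal d))) η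
        (fun _ x => A.mulVec x) Set.univ ∧
      IsKContractive k (scaledSupNorm (mulCompound k (Matrix.diagonal d))) η
        (fun _ x => A.mulVec x) Set.univ := by
  have hh (α : IncSeq k n) : 0 < ∏ p, d (α p) := Finset.prod_pos fun p _ => hd _
  have hrow := addCompound_row_le hk hd hA
  have : Nonempty (IncSeq k n) := ⟨Fin.castLEOrderEmb hkn⟩
  rw [mulCompound_diagonal]
  constructor
  · intro t _ x _
    have hJ : LinearMap.toMatrix' (fderivWithin ℝ (fun x : Fin n → ℝ => A.mulVec x) univ x :
        (Fin n → ℝ) →ₗ[ℝ] (Fin n → ℝ)) = A := by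
      rw [fderivWithin_mulVec_univ]
      exact LinearMap.toMatrix'_toLin' A
    rw [hJ]
    exact ⟨_, isLogNorm_scaledSupNorm_diagonal hh _,
      Finset.sup'_le _ _ fun α _ => hrow α⟩
  -- The Jacobian is `A` everywhere, so the variational equation is `w' = A w`.
  · intro s t _ hst x w _ hw
    refine scaledSupNorm_le_exp_mul hh hrow (y := fun τ => wedge fun i => w i τ) hst
      fun τ hτ α => ?_
    refine hasDerivWithinAt_mulCompound A
      (X := fun τ => Matrix.of fun i j => w j τ i) (fun i j => ?_) α _
    have := hw j τ hτ
    rw [fderivWithin_mulVec_univ] at this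
    exact hasDerivWithinAt_pi.1 this i
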